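/- For $\epsilon>0$ with $\epsilon+\epsilon^3<1$ let $\pi$ be the distribution on $\mathcal X=\{1,2,3,4\}$ with $$\pi(\{1\})=\epsilon,\qquad \pi(\{2\})=\epsilon^3,\qquad \pi(\{3\})=\pi(\{4\})=\tfrac{1-\epsilon-\epsilon^3}{2}.$$ For $\gamma\in\Gamma=\{1,2\}$ let $P_\gamma$ be the Metropolis kernel on $\mathcal X$ with target $\pi$ and proposal $Q_\gamma(x,\cdot)$, where $Q_1(x,\cdot)$ is uniform on $\{x-1,x+1\}$ and $Q_2(x,\cdot)$ is uniform on $\{x-2,x-1,x+1,x+2\}$: a proposal $y\in\mathcal X$ from $x$ is accepted with probability $\min\{1,\pi(\{y\})/\pi(\{x\})\}$, and a proposal outside $\mathcal X$ is always rejected; after a rejection the chain stays at $x$. Consider the adaptive chain $(X_n)_{n\ge 0}$ produced as follows. Start with $X_0=X_1=X_2=1$ and $\gamma_2=1$. For $k=1,2,3,\dots$ do the following. 1. Sample $X_{2^{k^2}+1}\sim P_{\gamma_{2^{k^2}}}(X_{2^{k^2}},\cdot)$. 2. If $\gamma_{2^{k^2}}=1$, set $\gamma_{2^{(k+1)^2}}=2$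 if $X_{2^{k^2}+1}\ne X_{2^{k^2}}$ and $\gamma_{2^{(k+1)^2}}=1$ otherwise. If $\gamma_{2^{k^2}}=2$, set $\gamma_{2^{(k+1)^2}}=1$ if $X_{2^{k^2}+1}=1$ and $\gamma_{2^{(k+1)^2}}=2$ otherwise. 3. For $2^{k^2}+2\le n\le 2^{(k+1)^2}$ sample $X_n\sim P_{\gamma_{2^{(k+1)^2}}}(X_{n-1},\cdot)$. Then the following hold. (a) For every $\epsilon>0$ with $\epsilon+\epsilon^3<1$, the kernels $P_1$ and $P_2$ are $\pi$-invariant, $\pi$-irreducible and aperiodic, and there is a set $C\subseteq\mathcal X$ with $\pi(C)>0$ for which the following two conditions hold. * (Simultaneous minorisation.) There are a probability measure $\nu$ on $\mathcal X$ and a constant $\delta>0$ such that $P_\gamma(x,\cdot)\ge\delta\,\nu(\cdot)$ for all $x\in C$ and $\gamma\in\Gamma$. * (Simultaneous geometric drift.) There are a function $V:\mathcal X\to[1,\infty)$ and constants $0<\lambda<1$ and $b<\infty$ such that $P_\gamma V\le\lambda V+b\,I_C$ for all $\gamma\in\Gamma$. (b) For every $\epsilon>0$ with $\epsilon+\epsilon^3<1$,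 the strong law of large numbers holds: for every $f:\mathcal X\to\mathbb R$, almost surely $$\frac1N\sum_{i=0}^{N-1}f(X_i)\longrightarrow\sum_{x\in\mathcal X}f(x)\,\pi(\{x\})\qquad(N\to\infty).$$ (c) There is $\epsilon_0>0$ such that, for every $\epsilon\in(0,\epsilon_0)$ with $\epsilon+\epsilon^3<1$, the chain $(X_n)$ does not converge in distribution: there is no probability measure $\mu$ on $\mathcal X$ (in particular $\mu=\pi$ fails) such that $\lim_{n\to\infty}\mathbb P(X_n\in A)=\mu(A)$ for every $A\subseteq\mathcal X$. -/

import Mathlib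

open MeasureTheory ProbabilityTheory Filter Topology

namespace AirMCMC

section General

variable {S G : Type*} [MeasurableSpace S]

/-- Aperiodicity of a kernel with respect to a reference measure `φ` (for a `φ`-irreducible,
`φ`-invariant kernel this is the usual notion): there is no `d`-cycle with `d ≥ 2`, that is, no
pairwise disjoint measurable sets `D i`, indexed cyclically by `ZMod d`, which cover the space up
to a `φ`-null set and which the kernel maps one into the next with probability one. -/
def IsAperiodic (φ : Measure S) (κ : Kernel S S) : Prop :=
  ∀ d : ℕ, 2 ≤ d → ¬ ∃ D : ZMod d → Set S,
    (∀ i, MeasurableSet (D i)) ∧ Pairwise (fun i j => Disjoint (D i) (D j)) ∧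
    (∀ i, ∀ x ∈ D i, κ x (D (i + 1)) = 1) ∧ φ (⋃ i, D i)ᶜ = 0

/-- Simultaneous one-step minorisation: `P γ x ≥ δ • ν` for all `x ∈ C` and all `γ`, where
`π C > 0`, `δ > 0` and `ν` is a probability measure. -/
def SimultaneousMinorisation (π : Measure S) (P : G → Kernel S S) (C : Set S) : Prop :=
  MeasurableSet C ∧ 0 < π C ∧
    ∃ (ν : Measure S) (δ : ℝ), IsProbabilityMeasure ν ∧ 0 < δ ∧
      ∀ γ : G, ∀ x ∈ C, ENNReal.ofReal δ • ν ≤ P γ x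

/-- The standing regularity and small set assumption on a family of kernels. -/
structure RegularAndSmallSet (π : Measure S) (P : G → Kernel S S) (C : Set S) : Prop where
  invariant : ∀ γ, (P γ).Invariant π
  irreducible : ∀ γ, (P γ).IsIrreducible π
  aperiodic : ∀ γ, IsAperiodic π (P γ)
  minorisation : SimultaneousMinorisation π P C

/-- Simultaneous geometric drift `P γ V ≤ lam V + b 1_C`, with `V ≥ 1` and `0 < lam < 1`. -/
def SimultaneousGeometricDrift (P : G → Kernel S S) (C : Set S) : Prop :=
  ∃ (V : S → ℝ) (lam b : ℝ), Measurable V ∧ (∀ x, 1 ≤ V x) ∧ 0 < lam ∧ lam < 1 ∧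
    ∀ γ x, ∫⁻ y, ENNReal.ofReal (V y) ∂(P γ x)
      ≤ ENNReal.ofReal (lam * V x + b * C.indicator (fun _ => 1) x)

/-- The laws of `X 0, X 1, …` under `μ` converge to some probability measure, setwise. -/
def ConvergesInDistribution {Ω : Type*} [MeasurableSpace Ω] (μ : Measure Ω) (X : ℕ → Ω → S) :
    Prop :=
  ∃ ν : Measure S, IsProbabilityMeasure ν ∧
    ∀ A, MeasurableSet A → Tendsto (fun n => μ (X n ⁻¹' A)) atTop (𝓝 (ν A))

end General

/-! ### The two Metropolis kernels on four points -/

/-- The state space `{1, 2, 3, 4}`; the index `i : Fin 4` stands for the point `i + 1`. -/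
abbrev State : Type := Fin 4

/-- The parameter set `{1, 2}`; the index `0` stands for `1` and the index `1` for `2`. -/
abbrev Param : Type := Fin 2

/-- The values of `ε` for which the target below is a distribution with full support. -/
structure Admissible (ε : ℝ) : Prop where
  pos : 0 < ε
  lt_one : ε + ε ^ 3 < 1

/-- Weights of the target: `ε, ε³, (1 - ε - ε³)/2, (1 - ε - ε³)/2` at the points `1, 2, 3, 4`. -/
noncomputable def weight (ε : ℝ) : State → ℝ :=
  ![ε, ε ^ 3, (1 - ε - ε ^ 3) / 2, (1 - ε - ε ^ 3) / 2]

/-- Probability that the proposal from `x` is `y`, for integers `x`, `y`: uniform on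
`{x - 1, x + 1}` for the first parameter, on `{x - 2, x - 1, x + 1, x + 2}` for the second. -/
noncomputable def proposal (g : Param) (x y : ℤ) : ℝ :=
  if g = 0 then (if |y - x| = 1 then 1 / 2 else 0)
  else (if |y - x| = 1 ∨ |y - x| = 2 then 1 / 4 else 0)

/-- Probability that the point `y ≠ x` of the state space is proposed from `x` and accepted. -/
noncomputable def moveProb (ε : ℝ) (g : Param) (x y : State) : ℝ :=
  proposal g ((x : ℕ) : ℤ) ((y : ℕ) : ℤ) * min 1 (weight ε y / weight ε x)

/-- Metropolis transition probabilities. The remaining mass stays at `x`; it includes all proposals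
outside the state space, which are always rejected. -/
noncomputable def transProb (ε : ℝ) (g : Param) (x y : State) : ℝ :=
  if y = x then 1 - ∑ z ∈ Finset.univ.erase x, moveProb ε g x z else moveProb ε g x y

theorem weight_pos {ε : ℝ} (h : Admissible ε) (x : State) : 0 < weight ε x := by
  have h1 := h.pos
  have h2 := h.lt_one
  have h3 : 0 < ε ^ 3 := by positivity
  fin_cases x <;> simp [weight] <;> linarith

theorem sum_weight (ε : ℝ) : ∑ x, weight ε x = 1 := by
  simp [weight, Fin.sum_univ_four]
  ring

theorem proposal_nonneg (g : Param) (x y : ℤ) : 0 ≤ proposal g x y := by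
  unfold proposal
  split_ifs <;> norm_num

theorem sum_proposal_le (g : Param) (x : State) :
    ∑ z ∈ Finset.univ.erase x, proposal g ((x : ℕ) : ℤ) ((z : ℕ) : ℤ) ≤ 1 := by
  refine (Finset.sum_le_sum_of_subset_of_nonneg (Finset.erase_subset _ _)
    fun z _ _ => proposal_nonneg _ _ _).trans ?_
  fin_cases g <;> fin_cases x <;> norm_num [Fin.sum_univ_four, proposal]

theorem moveProb_nonneg {ε : ℝ} (h : Admissible ε) (g : Param) (x y : State) :
    0 ≤ moveProb ε g x y :=
  mul_nonneg (proposal_nonneg _ _ _)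
    (le_min zero_le_one (div_nonneg (weight_pos h y).le (weight_pos h x).le))

theorem transProb_nonneg {ε : ℝ} (h : Admissible ε) (g : Param) (x y : State) :
    0 ≤ transProb ε g x y := by
  unfold transProb
  split_ifs
  · refine sub_nonneg.2 ((Finset.sum_le_sum fun z _ => ?_).trans (sum_proposal_le g x))
    exact mul_le_of_le_one_right (proposal_nonneg _ _ _) (min_le_left _ _)
  · exact moveProb_nonneg h g x y

theorem sum_transProb (ε : ℝ) (g : Param) (x : State) : ∑ y, transProb ε g x y = 1 := by
  rw [← Finset.add_sum_erase _ _ (Finset.mem_univ x)]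
  have : ∑ y ∈ Finset.univ.erase x, transProb ε g x y
      = ∑ y ∈ Finset.univ.erase x, moveProb ε g x y :=
    Finset.sum_congr rfl fun y hy => by simp [transProb, Finset.ne_of_mem_erase hy]
  rw [this]
  simp [transProb]

/-- The target distribution. -/
noncomputable def targetPMF (ε : ℝ) (h : Admissible ε) : PMF State :=
  PMF.ofFintype (fun x => ENNReal.ofReal (weight ε x)) (by
    rw [← ENNReal.ofReal_sum_of_nonneg fun x _ => (weight_pos h x).le, sum_weight,
      ENNReal.ofReal_one])

noncomputable def target (ε : ℝ) (h : Admissible ε) : Measure State := (targetPMF ε h).toMeasure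

/-- One step of the Metropolis algorithm with parameter `g` from the point `x`. -/
noncomputable def metropolisPMF (ε : ℝ) (h : Admissible ε) (g : Param) (x : State) : PMF State :=
  PMF.ofFintype (fun y => ENNReal.ofReal (transProb ε g x y)) (by
    rw [← ENNReal.ofReal_sum_of_nonneg fun y _ => transProb_nonneg h g x y, sum_transProb,
      ENNReal.ofReal_one])

noncomputable def metropolis (ε : ℝ) (h : Admissible ε) (g : Param) : Kernel State State :=
  Kernel.ofFunOfCountable fun x => (metropolisPMF ε h g x).toMeasure

/-! ### The adaptive algorithm -/

/-- The adaptation rule: `g` is the current parameter, the chain has just moved from `x` to `y`.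
From parameter `1`: switch to `2` if the chain moved, else keep `1`. From parameter `2`: switch
to `1` if the chain is now at the point `1`, else keep `2`. -/
def adapt (g : Param) (x y : State) : Param :=
  if g = 0 then (if y ≠ x then 1 else 0) else (if y = 0 then 0 else 1)

open Classical in
/-- One step of the algorithm. A pair `(x, g)` at time `n` consists of the position `X n` and of the
parameter that is used to draw `X (n + 1)`. The pairs at times `0, 1, 2` are the point `1` with
parameter `1`. For `n ≥ 2`, `X (n + 1)` is drawn from the kernel of parameter `g`, and right after
this draw the parameter is updated if `n = 2 ^ (k ^ 2)` for some `k ≥ 1`, and is kept otherwise. -/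
noncomputable def stepPMF (ε : ℝ) (h : Admissible ε) (n : ℕ) (s : State × Param) :
    PMF (State × Param) :=
  if n < 2 then PMF.pure (0, 0)
  else (metropolisPMF ε h s.2 s.1).map fun y =>
    (y, if ∃ k : ℕ, 1 ≤ k ∧ n = 2 ^ (k ^ 2) then adapt s.2 s.1 y else s.2)

/-- The step at time `n` as a kernel from histories up to time `n`. -/
noncomputable def stepKernel (ε : ℝ) (h : Admissible ε) (n : ℕ) :
    Kernel (Finset.Iic n → State × Param) (State × Param) :=
  Kernel.ofFunOfCountable fun p => (stepPMF ε h n (p ⟨n, Finset.mem_Iic.2 le_rfl⟩)).toMeasure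

instance (ε : ℝ) (h : Admissible ε) (n : ℕ) : IsMarkovKernel (stepKernel ε h n) :=
  ⟨fun p => by
    change IsProbabilityMeasure
      (stepPMF ε h n (p ⟨n, Finset.mem_Iic.2 le_rfl⟩)).toMeasure
    infer_instance⟩

/-- The law of the trajectory `(X n, parameter in force at time n)`, `n = 0, 1, 2, …`, started at
the point `1` with parameter `1`. -/
noncomputable def chainLaw (ε : ℝ) (h : Admissible ε) : Measure (ℕ → State × Param) :=
  Kernel.trajMeasure (X := fun _ => State × Param) (Measure.dirac (0, 0)) (stepKernel ε h)

/-- The chain `X n`. -/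
def chain (n : ℕ) (ω : ℕ → State × Param) : State := (ω n).1

end AirMCMC

namespace AirMCMC

/-! Both kernels are reversible for the target, and in exactly three steps each reaches every state
from every state. Three steps therefore shrink the range of a function by a fixed factor, so
iterates converge to the stationary mean (`tendsto_transOp_iterate`) and the Poisson equation is
solvable for each parameter (`exists_poisson`).

Strong law. Let `u g` solve the Poisson equation for parameter `g`. While the parameter is kept, the
centred value of `f` at time `i` is a martingale difference plus a telescoping term. Bounded
martingale differences are orthogonal, so their averages vanish almost surely
(`ae_tendsto_average_of_orthogonal`). The telescoping fails only at update times, of which there are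
at most logarithmically many (`tendsto_average_of_telescoping`).

No limit law. The gaps between update times grow, so at an update time the position is nearly
stationary given the parameter (`tendsto_expect_update`). Along these times point 1 has asymptotic
probability `ε`, and a limit law would have to give it that mass. The update, however, looks at the
move just made: it favours the first kernel when the chain sits at point 1, and that kernel leaves
this point less easily. Two steps after an update, point 1 has asymptotic probability at least a
constant larger than `ε`, whatever the parameter was (`lt_mean_twoStep`).

Regularity and drift are explicit, with small set the two heavy points 3 and 4 (indices `2`, `3`).
-/

/-! ### Transition operators, stationary mean and reversibility -/

/-- The transition operator of the Metropolis kernel, acting on functions. -/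
noncomputable def transOp (ε : ℝ) (g : Param) : (State → ℝ) →ₗ[ℝ] (State → ℝ) where
  toFun h x := ∑ y, transProb ε g x y * h y
  map_add' u v := by
    ext x
    simp [mul_add, Finset.sum_add_distrib]
  map_smul' c u := by
    ext x
    simp only [Pi.smul_apply, smul_eq_mul, RingHom.id_apply, Finset.mul_sum]
    exact Finset.sum_congr rfl fun y _ => by ring

theorem transOp_apply (ε : ℝ) (g : Param) (h : State → ℝ) (x : State) :
    transOp ε g h x = ∑ y, transProb ε g x y * h y := rfl

/-- The expectation under the target distribution. -/
noncomputable def mean (ε : ℝ) : (State → ℝ) →ₗ[ℝ] ℝ where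
  toFun h := ∑ x, weight ε x * h x
  map_add' u v := by simp [mul_add, Finset.sum_add_distrib]
  map_smul' c u := by
    simp only [Pi.smul_apply, smul_eq_mul, RingHom.id_apply, Finset.mul_sum]
    exact Finset.sum_congr rfl fun y _ => by ring

theorem mean_apply (ε : ℝ) (h : State → ℝ) : mean ε h = ∑ x, weight ε x * h x := rfl

theorem mean_const (ε c : ℝ) : mean ε (fun _ => c) = c := by
  rw [mean_apply, ← Finset.sum_mul, sum_weight, one_mul]

theorem transOp_const (ε : ℝ) (g : Param) (c : ℝ) : transOp ε g (fun _ => c) = fun _ => c := by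
  ext x
  rw [transOp_apply, ← Finset.sum_mul, sum_transProb, one_mul]

theorem proposal_comm (g : Param) (x y : ℤ) : proposal g x y = proposal g y x := by
  unfold proposal
  rw [abs_sub_comm]

/-- The proposal is symmetric, and the weight of `a` times the acceptance probability from `a` to
`b` is the minimum of the two weights, symmetric as well. -/
theorem detailed_balance {ε : ℝ} (h : Admissible ε) (g : Param) (x y : State) :
    weight ε x * transProb ε g x y = weight ε y * transProb ε g y x := by
  have key (a b : State) :
      weight ε a * min 1 (weight ε b / weight ε a) = min (weight ε a) (weight ε b) := by
    rw [mul_min_of_nonneg _ _ (weight_pos h a).le, mul_one,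
      mul_div_cancel₀ _ (weight_pos h a).ne']
  rcases eq_or_ne x y with rfl | hxy
  · rfl
  · simp only [transProb, hxy, hxy.symm, if_false, moveProb]
    rw [mul_left_comm, key, mul_left_comm, key, min_comm, proposal_comm]

theorem mean_transOp {ε : ℝ} (h : Admissible ε) (g : Param) (u : State → ℝ) :
    mean ε (transOp ε g u) = mean ε u := by
  simp only [mean_apply, transOp_apply, Finset.mul_sum]
  rw [Finset.sum_comm]
  refine Finset.sum_congr rfl fun y _ => ?_
  calc ∑ x, weight ε x * (transProb ε g x y * u y)
      = ∑ x, (weight ε y * u y) * transProb ε g y x := by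
        refine Finset.sum_congr rfl fun x _ => ?_
        rw [← mul_assoc, detailed_balance h]
        ring
    _ = weight ε y * u y := by rw [← Finset.mul_sum, sum_transProb, mul_one]

/-! ### Three-step positivity, convergence to the mean, Poisson equation -/

/-- The pairs of states between which both Metropolis kernels move with positive
probability: neighbours, and the holding steps at the two end points. -/
def Linked (x y : State) : Prop :=
  (x : ℕ) + 1 = y ∨ (y : ℕ) + 1 = x ∨ (x = y ∧ (x = 0 ∨ x = 3))

instance (x y : State) : Decidable (Linked x y) := by
  unfold Linked
  infer_instance

theorem moveProb_le_proposal (ε : ℝ) (g : Param) (x y : State) :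
    moveProb ε g x y ≤ proposal g ((x : ℕ) : ℤ) ((y : ℕ) : ℤ) :=
  mul_le_of_le_one_right (proposal_nonneg _ _ _) (min_le_left _ _)

/-- At an end point half of the proposal mass falls outside the state space, for either parameter.
-/
theorem half_le_transProb_end (ε : ℝ) (g : Param) (x : State) (hx : x = 0 ∨ x = 3) :
    1 / 2 ≤ transProb ε g x x := by
  have hle : ∑ z ∈ Finset.univ.erase x, moveProb ε g x z ≤ 1 / 2 := by
    refine (Finset.sum_le_sum fun z _ => moveProb_le_proposal ε g x z).trans ?_
    refine (Finset.sum_le_sum_of_subset_of_nonneg (Finset.erase_subset _ _)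
      fun z _ _ => proposal_nonneg _ _ _).trans ?_
    rcases hx with rfl | rfl <;> fin_cases g <;> norm_num [Fin.sum_univ_four, proposal]
  simp only [transProb, if_true]
  linarith

theorem transProb_pos_of_linked {ε : ℝ} (h : Admissible ε) (g : Param) {x y : State}
    (hxy : Linked x y) : 0 < transProb ε g x y := by
  by_cases hne : y = x
  · subst hne
    have : y = 0 ∨ y = 3 := by
      rcases hxy with h1 | h1 | h1
      · omega
      · omega
      · exact h1.2
    exact lt_of_lt_of_le (by norm_num) (half_le_transProb_end ε g y this)
  · have habs : |((y : ℕ) : ℤ) - ((x : ℕ) : ℤ)| = 1 := by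
      rcases hxy with h1 | h1 | h1
      · rw [← h1]; simp
      · rw [← h1]; simp
      · exact absurd h1.1.symm hne
    have hp : 0 < proposal g ((x : ℕ) : ℤ) ((y : ℕ) : ℤ) := by
      unfold proposal
      simp only [habs, true_or, if_true]
      split_ifs <;> norm_num
    simp only [transProb, hne, if_false, moveProb]
    exact mul_pos hp (lt_min one_pos (div_pos (weight_pos h y) (weight_pos h x)))

/-- Three steps are needed to cross from one end to the other; holding at the ends corrects length
and parity for the other pairs. -/
theorem exists_linked_path (x y : State) : ∃ a b, Linked x a ∧ Linked a b ∧ Linked b y := by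
  revert x y
  decide

/-- The three-step transition probabilities. -/
noncomputable def transProb₃ (ε : ℝ) (g : Param) (x y : State) : ℝ :=
  ∑ a, ∑ b, transProb ε g x a * transProb ε g a b * transProb ε g b y

theorem transOp_iterate_three (ε : ℝ) (g : Param) (u : State → ℝ) (x : State) :
    ((transOp ε g)^[3] u) x = ∑ y, transProb₃ ε g x y * u y := by
  simp only [Function.iterate_succ, Function.iterate_zero, Function.comp_apply, id_eq,
    transOp_apply, transProb₃, Fin.sum_univ_four]
  ring

theorem sum_transProb₃ (ε : ℝ) (g : Param) (x : State) : ∑ y, transProb₃ ε g x y = 1 := by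
  have h1 := transOp_iterate_three ε g (fun _ => 1) x
  simpa [transOp_const] using h1.symm

theorem transProb₃_pos {ε : ℝ} (h : Admissible ε) (g : Param) (x y : State) :
    0 < transProb₃ ε g x y := by
  obtain ⟨a, b, h1, h2, h3⟩ := exists_linked_path x y
  have hn (a b : State) : 0 ≤ transProb ε g x a * transProb ε g a b * transProb ε g b y := by
    have := transProb_nonneg h g
    exact mul_nonneg (mul_nonneg (this _ _) (this _ _)) (this _ _)
  refine Finset.sum_pos' (fun a _ => Finset.sum_nonneg fun b _ => hn a b)
    ⟨a, Finset.mem_univ _, Finset.sum_pos' (fun b _ => hn a b) ⟨b, Finset.mem_univ _, ?_⟩⟩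
  exact mul_pos (mul_pos (transProb_pos_of_linked h g h1) (transProb_pos_of_linked h g h2))
    (transProb_pos_of_linked h g h3)

theorem exists_transProb₃_lower {ε : ℝ} (h : Admissible ε) :
    ∃ δ : ℝ, 0 < δ ∧ δ < 1 ∧ ∀ g x y, δ ≤ transProb₃ ε g x y := by
  obtain ⟨⟨g, x, y⟩, hm⟩ :=
    Finite.exists_min (fun p : Param × State × State => transProb₃ ε p.1 p.2.1 p.2.2)
  refine ⟨min (transProb₃ ε g x y) (1 / 2), lt_min (transProb₃_pos h g x y) (by norm_num),
    (min_le_right _ _).trans_lt (by norm_num),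
    fun g' x' y' => (min_le_left _ _).trans (hm (g', x', y'))⟩

/-- If `a ≤ u ≤ b` then three steps shrink the range of `u` by the factor `1 - δ`. -/
theorem exists_bounds_iterate_three {ε δ : ℝ} {g : Param} (hδ : 0 ≤ δ)
    (hlow : ∀ x y, δ ≤ transProb₃ ε g x y) {u : State → ℝ} {a b : ℝ} (hu : ∀ x, u x ∈ Set.Icc a b) :
    ∃ a' b', b' - a' ≤ (1 - δ) * (b - a) ∧ ∀ x, ((transOp ε g)^[3] u) x ∈ Set.Icc a' b' := by
  -- From every state the three-step law gives state `0` mass at least `δ`. Keeping `u 0` on that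
  -- mass and bounding the rest by `a` or `b` yields these end points.
  refine ⟨a + δ * (u 0 - a), b - δ * (b - u 0), by linarith, fun x => ?_⟩
  have hs := sum_transProb₃ ε g x
  rw [transOp_iterate_three]
  rw [Fin.sum_univ_four] at hs ⊢
  have e0 := hu 0; have e1 := hu 1; have e2 := hu 2; have e3 := hu 3
  have p0 := hlow x 0; have p1 := hlow x 1; have p2 := hlow x 2; have p3 := hlow x 3
  simp only [Set.mem_Icc] at *
  have ha := congrArg (a * ·) hs
  have hb := congrArg (b * ·) hs
  constructor
  · linarith [mul_nonneg (sub_nonneg.2 p0) (sub_nonneg.2 e0.1),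
      mul_nonneg (hδ.trans p1) (sub_nonneg.2 e1.1), mul_nonneg (hδ.trans p2) (sub_nonneg.2 e2.1),
      mul_nonneg (hδ.trans p3) (sub_nonneg.2 e3.1)]
  · linarith [mul_nonneg (sub_nonneg.2 p0) (sub_nonneg.2 e0.2),
      mul_nonneg (hδ.trans p1) (sub_nonneg.2 e1.2), mul_nonneg (hδ.trans p2) (sub_nonneg.2 e2.2),
      mul_nonneg (hδ.trans p3) (sub_nonneg.2 e3.2)]

theorem transOp_mem_Icc {ε : ℝ} (h : Admissible ε) (g : Param) {u : State → ℝ} {a b : ℝ}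
    (hu : ∀ x, u x ∈ Set.Icc a b) (x : State) : transOp ε g u x ∈ Set.Icc a b := by
  have hs := sum_transProb ε g x
  have hp := transProb_nonneg h g x
  rw [transOp_apply]
  constructor
  · calc a = ∑ y, transProb ε g x y * a := by rw [← Finset.sum_mul, hs, one_mul]
      _ ≤ _ := Finset.sum_le_sum fun y _ => mul_le_mul_of_nonneg_left (hu y).1 (hp y)
  · calc _ ≤ ∑ y, transProb ε g x y * b :=
          Finset.sum_le_sum fun y _ => mul_le_mul_of_nonneg_left (hu y).2 (hp y)
      _ = b := by rw [← Finset.sum_mul, hs, one_mul]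

theorem mean_mem_Icc {ε : ℝ} (h : Admissible ε) {u : State → ℝ} {a b : ℝ}
    (hu : ∀ x, u x ∈ Set.Icc a b) : mean ε u ∈ Set.Icc a b := by
  have hp := fun x => (weight_pos h x).le
  constructor
  · calc a = ∑ y, weight ε y * a := by rw [← Finset.sum_mul, sum_weight, one_mul]
      _ ≤ _ := Finset.sum_le_sum fun y _ => mul_le_mul_of_nonneg_left (hu y).1 (hp y)
  · calc _ ≤ ∑ y, weight ε y * b :=
          Finset.sum_le_sum fun y _ => mul_le_mul_of_nonneg_left (hu y).2 (hp y)
      _ = b := by rw [← Finset.sum_mul, sum_weight, one_mul]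

theorem mean_transOp_iterate {ε : ℝ} (h : Admissible ε) (g : Param) (u : State → ℝ) (n : ℕ) :
    mean ε ((transOp ε g)^[n] u) = mean ε u := by
  induction n with
  | zero => rfl
  | succ n ih => rw [Function.iterate_succ_apply', mean_transOp h, ih]

theorem exists_bounds_iterate {ε δ : ℝ} (h : Admissible ε) {g : Param} (hδ : 0 ≤ δ) (hδ1 : δ ≤ 1)
    (hlow : ∀ x y, δ ≤ transProb₃ ε g x y) {u : State → ℝ} {a b : ℝ}
    (hu : ∀ x, u x ∈ Set.Icc a b) (n : ℕ) :
    ∃ a' b', b' - a' ≤ (1 - δ) ^ (n / 3) * (b - a) ∧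
      ∀ x, ((transOp ε g)^[n] u) x ∈ Set.Icc a' b' := by
  have three (k : ℕ) : ∃ a' b', b' - a' ≤ (1 - δ) ^ k * (b - a) ∧
      ∀ x, ((transOp ε g)^[3 * k] u) x ∈ Set.Icc a' b' := by
    induction k with
    | zero => exact ⟨a, b, by simp, hu⟩
    | succ k ih =>
      obtain ⟨a', b', h1, h2⟩ := ih
      obtain ⟨a'', b'', h3, h4⟩ := exists_bounds_iterate_three hδ hlow h2
      refine ⟨a'', b'', h3.trans ?_, fun x => ?_⟩
      · rw [pow_succ']
        nlinarith
      · rw [show 3 * (k + 1) = 3 + 3 * k by ring, Function.iterate_add_apply]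
        exact h4 x
  obtain ⟨a', b', h1, h2⟩ := three (n / 3)
  refine ⟨a', b', h1, ?_⟩
  have extra (j : ℕ) (x : State) : ((transOp ε g)^[j] ((transOp ε g)^[3 * (n / 3)] u)) x ∈
      Set.Icc a' b' := by
    induction j generalizing x with
    | zero => exact h2 x
    | succ j ih =>
      rw [Function.iterate_succ_apply']
      exact transOp_mem_Icc h g ih x
  intro x
  have := extra (n % 3) x
  rwa [← Function.iterate_add_apply, Nat.mod_add_div] at this

/-- The iterates of the transition operators converge to the stationary mean. -/
theorem tendsto_transOp_iterate {ε : ℝ} (h : Admissible ε) (g : Param) (u : State → ℝ)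
    (x : State) : Tendsto (fun n => ((transOp ε g)^[n] u) x) atTop (𝓝 (mean ε u)) := by
  obtain ⟨δ, hδ, hδ1, hlow⟩ := exists_transProb₃_lower h
  obtain ⟨i, hi⟩ := Finite.exists_min u
  obtain ⟨j, hj⟩ := Finite.exists_max u
  have hbd (n : ℕ) : |((transOp ε g)^[n] u) x - mean ε u| ≤ (1 - δ) ^ (n / 3) * (u j - u i) := by
    obtain ⟨a, b, h1, h2⟩ := exists_bounds_iterate h hδ.le hδ1.le (hlow g)
      (fun x => ⟨hi x, hj x⟩ : ∀ x, u x ∈ Set.Icc (u i) (u j)) n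
    have h3 := mean_mem_Icc h h2
    rw [mean_transOp_iterate h] at h3
    have h4 := h2 x
    rw [abs_le]
    constructor <;> linarith [h3.1, h3.2, h4.1, h4.2]
  have hlim : Tendsto (fun n : ℕ => (1 - δ) ^ (n / 3) * (u j - u i)) atTop (𝓝 0) := by
    have h1 : Tendsto (fun n : ℕ => (1 - δ) ^ n) atTop (𝓝 0) :=
      tendsto_pow_atTop_nhds_zero_of_lt_one (by linarith) (by linarith)
    have h2 : Tendsto (fun n : ℕ => n / 3) atTop atTop :=
      Nat.tendsto_div_const_atTop (by norm_num)
    simpa using (h1.comp h2).mul_const (u j - u i)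
  rw [tendsto_iff_norm_sub_tendsto_zero]
  exact squeeze_zero (fun n => norm_nonneg _) hbd hlim

/-- Solvability of the Poisson equation. -/
theorem exists_poisson {ε : ℝ} (h : Admissible ε) (g : Param) (f : State → ℝ) :
    ∃ u : State → ℝ, ∀ x, f x - mean ε f = u x - transOp ε g u x := by
  -- Adding the rank-one mean term removes the constants from the kernel of `id - P`. A null vector
  -- of `L` has mean zero and is fixed by `P`, hence equals the limit of its iterates, which is
  -- zero. In finite dimension injectivity gives surjectivity.
  let L : (State → ℝ) →ₗ[ℝ] (State → ℝ) :=
    LinearMap.id - transOp ε g + (mean ε).smulRight (fun _ => (1 : ℝ))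
  have hL (u : State → ℝ) : L u = u - transOp ε g u + fun _ => mean ε u := by
    ext x
    simp [L]
  have hmean (u : State → ℝ) : mean ε (L u) = mean ε u := by
    rw [hL, map_add, map_sub, mean_transOp h, mean_const]
    ring
  have hinj : Function.Injective L := by
    rw [injective_iff_map_eq_zero]
    intro u hu
    have h0 : mean ε u = 0 := by rw [← hmean, hu, map_zero]
    have hfix : transOp ε g u = u := by
      ext x
      have := congrFun ((hL u).symm.trans hu) x
      simp only [Pi.add_apply, Pi.sub_apply, h0, Pi.zero_apply] at this
      linarith
    ext x
    have hlim := tendsto_transOp_iterate h g u x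
    simp only [Function.iterate_fixed hfix, h0] at hlim
    exact tendsto_nhds_unique tendsto_const_nhds hlim
  obtain ⟨u, hu⟩ := LinearMap.injective_iff_surjective.1 hinj (fun x => f x - mean ε f)
  have h0 : mean ε u = 0 := by
    rw [← hmean, hu]
    have : (fun x => f x - mean ε f) = f - fun _ => mean ε f := rfl
    rw [this, map_sub, mean_const, sub_self]
  refine ⟨u, fun x => ?_⟩
  have := congrFun (hu.symm.trans (hL u)) x
  simpa [h0] using this

/-! ### Invariance, irreducibility, aperiodicity, minorisation and drift -/

theorem transOp_eq_add_sum_moveProb (ε : ℝ) (g : Param) (u : State → ℝ) (x : State) :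
    transOp ε g u x = u x + ∑ y, moveProb ε g x y * (u y - u x) := by
  rw [transOp_apply, ← Finset.add_sum_erase _ _ (Finset.mem_univ x),
    ← Finset.add_sum_erase _ (fun y => moveProb ε g x y * (u y - u x)) (Finset.mem_univ x),
    Finset.sum_congr rfl (g := fun y => moveProb ε g x y * u y) fun y hy => by
      simp [transProb, Finset.ne_of_mem_erase hy]]
  simp only [transProb, if_true, mul_sub, Finset.sum_sub_distrib, ← Finset.sum_mul]
  ring

theorem weight_zero (ε : ℝ) : weight ε 0 = ε := rfl

theorem weight_one (ε : ℝ) : weight ε 1 = ε ^ 3 := rfl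

theorem weight_two (ε : ℝ) : weight ε 2 = (1 - ε - ε ^ 3) / 2 := rfl

theorem weight_three (ε : ℝ) : weight ε 3 = (1 - ε - ε ^ 3) / 2 := rfl

theorem target_singleton {ε : ℝ} (h : Admissible ε) (x : State) :
    target ε h {x} = ENNReal.ofReal (weight ε x) := by
  rw [target, PMF.toMeasure_apply_singleton _ _ (measurableSet_singleton x)]
  rfl

theorem target_pos {ε : ℝ} (h : Admissible ε) {A : Set State} {x : State} (hx : x ∈ A) :
    0 < target ε h A := by
  refine lt_of_lt_of_le ?_ (measure_mono (Set.singleton_subset_iff.2 hx))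
  rw [target_singleton]
  exact ENNReal.ofReal_pos.2 (weight_pos h x)

instance (ε : ℝ) (h : Admissible ε) : IsProbabilityMeasure (target ε h) := by
  unfold target
  infer_instance

theorem integral_target {ε : ℝ} (h : Admissible ε) (f : State → ℝ) :
    ∫ x, f x ∂(target ε h) = mean ε f := by
  rw [integral_fintype Integrable.of_finite, mean_apply]
  refine Finset.sum_congr rfl fun x _ => ?_
  rw [measureReal_def, target_singleton, ENNReal.toReal_ofReal (weight_pos h x).le, smul_eq_mul]

theorem metropolis_singleton {ε : ℝ} (h : Admissible ε) (g : Param) (x y : State) :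
    metropolis ε h g x {y} = ENNReal.ofReal (transProb ε g x y) := by
  change (metropolisPMF ε h g x).toMeasure {y} = _
  rw [PMF.toMeasure_apply_singleton _ _ (measurableSet_singleton y)]
  rfl

instance (ε : ℝ) (h : Admissible ε) (g : Param) : IsMarkovKernel (metropolis ε h g) :=
  ⟨fun x => by
    change IsProbabilityMeasure (metropolisPMF ε h g x).toMeasure
    infer_instance⟩

theorem metropolis_pos {ε : ℝ} (h : Admissible ε) (g : Param) {x y : State}
    (hxy : 0 < transProb ε g x y) {A : Set State} (hy : y ∈ A) : 0 < metropolis ε h g x A := by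
  refine lt_of_lt_of_le ?_ (measure_mono (Set.singleton_subset_iff.2 hy))
  rw [metropolis_singleton]
  exact ENNReal.ofReal_pos.2 hxy

theorem lintegral_metropolis {ε : ℝ} (h : Admissible ε) (g : Param) (x : State) {V : State → ℝ}
    (hV : ∀ y, 0 ≤ V y) :
    ∫⁻ y, ENNReal.ofReal (V y) ∂(metropolis ε h g x) = ENNReal.ofReal (transOp ε g V x) := by
  rw [lintegral_fintype, transOp_apply, ENNReal.ofReal_sum_of_nonneg fun y _ =>
    mul_nonneg (transProb_nonneg h g x y) (hV y)]
  refine Finset.sum_congr rfl fun y _ => ?_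
  rw [metropolis_singleton, mul_comm, ENNReal.ofReal_mul (transProb_nonneg h g x y)]

theorem invariant_metropolis {ε : ℝ} (h : Admissible ε) (g : Param) :
    (metropolis ε h g).Invariant (target ε h) := by
  refine Measure.ext_of_singleton fun y => ?_
  rw [Measure.bind_apply (measurableSet_singleton y) (Kernel.aemeasurable _), lintegral_fintype,
    target_singleton]
  have hrow (x : State) : metropolis ε h g x {y} * target ε h {x} =
      ENNReal.ofReal (weight ε y * transProb ε g y x) := by
    rw [metropolis_singleton, target_singleton, ← ENNReal.ofReal_mul (transProb_nonneg h g x y),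
      ← detailed_balance h, mul_comm]
  simp only [hrow]
  rw [← ENNReal.ofReal_sum_of_nonneg fun x _ =>
    mul_nonneg (weight_pos h y).le (transProb_nonneg h g y x), ← Finset.mul_sum, sum_transProb,
    mul_one]

theorem pow_succ_pos_of_singleton_pos {α : Type*} [MeasurableSpace α] [MeasurableSingletonClass α]
    (κ : Kernel α α) (n : ℕ) {a b : α} {s : Set α} (hs : MeasurableSet s)
    (hab : 0 < κ a {b}) (hb : 0 < (κ ^ n) b s) : 0 < (κ ^ (n + 1)) a s := by
  rw [add_comm, Kernel.pow_add_apply_eq_lintegral κ 1 n a hs, pow_one]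
  calc 0 < (κ ^ n) b s * κ a {b} := ENNReal.mul_pos hb.ne' hab.ne'
    _ = ∫⁻ c in {b}, (κ ^ n) c s ∂(κ a) := by rw [lintegral_singleton]
    _ ≤ _ := setLIntegral_le_lintegral _ _

theorem irreducible_metropolis {ε : ℝ} (h : Admissible ε) (g : Param) :
    (metropolis ε h g).IsIrreducible (target ε h) := by
  refine ⟨fun A hA hpos x => ?_⟩
  obtain ⟨y, hy⟩ := nonempty_of_measure_ne_zero hpos.ne'
  obtain ⟨a, b, h1, h2, h3⟩ := exists_linked_path x y
  have hstep {c d : State} (hcd : Linked c d) : 0 < metropolis ε h g c {d} :=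
    metropolis_pos h g (transProb_pos_of_linked h g hcd) rfl
  refine ⟨3, pow_succ_pos_of_singleton_pos _ 2 hA (hstep h1)
    (pow_succ_pos_of_singleton_pos _ 1 hA (hstep h2) ?_)⟩
  rw [pow_one]
  exact metropolis_pos h g (transProb_pos_of_linked h g h3) hy

/-- State `0` has positive mass, so it lies in some class of the cycle; its positive holding
probability then contradicts leaving that class almost surely. -/
theorem aperiodic_metropolis {ε : ℝ} (h : Admissible ε) (g : Param) :
    IsAperiodic (target ε h) (metropolis ε h g) := by
  rintro d hd ⟨D, hmeas, hdisj, hcyc, hcov⟩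
  have hmem : (0 : State) ∈ ⋃ i, D i := by
    by_contra hn
    exact (target_pos h (Set.mem_compl hn)).ne' hcov
  obtain ⟨i, hi⟩ := Set.mem_iUnion.1 hmem
  have : Fact (1 < d) := ⟨hd⟩
  have hne : i ≠ i + 1 := by simp
  have hnot : (0 : State) ∈ (D (i + 1))ᶜ := fun hj => Set.disjoint_left.1 (hdisj hne) hi hj
  have hzero := (prob_compl_eq_zero_iff (hmeas (i + 1))).2 (hcyc i 0 hi)
  exact (metropolis_pos h g (transProb_pos_of_linked h g (by decide)) hnot).ne' hzero

theorem simultaneousMinorisation_metropolis {ε : ℝ} (h : Admissible ε) :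
    SimultaneousMinorisation (target ε h) (metropolis ε h) ({2, 3} : Set State) := by
  have hpos (g : Param) (x : State) (hx : x ∈ ({2, 3} : Set State)) :
      0 < transProb ε g x 3 := by
    rcases hx with rfl | rfl <;> exact transProb_pos_of_linked h g (by decide)
  obtain ⟨g₀, hg₀⟩ := Finite.exists_min fun g : Param =>
    min (transProb ε g 2 3) (transProb ε g 3 3)
  refine ⟨MeasurableSet.of_discrete, target_pos h (x := 2) (by simp), Measure.dirac 3,
    min (transProb ε g₀ 2 3) (transProb ε g₀ 3 3), inferInstance,
    lt_min (hpos _ _ (by simp)) (hpos _ _ (by simp)), fun g x hx => ?_⟩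
  refine Measure.le_iff.2 fun s _ => ?_
  by_cases hs : (3 : State) ∈ s
  · have h1 : metropolis ε h g x {3} ≤ metropolis ε h g x s :=
      measure_mono (Set.singleton_subset_iff.2 hs)
    refine le_trans ?_ h1
    rw [metropolis_singleton]
    simp only [Measure.smul_apply, Measure.dirac_apply, Set.indicator_of_mem hs, Pi.one_apply,
      smul_eq_mul, mul_one]
    refine ENNReal.ofReal_le_ofReal ((hg₀ g).trans ?_)
    rcases hx with rfl | rfl
    · exact min_le_left _ _
    · exact min_le_right _ _
  · simp [Set.indicator_of_notMem hs]

/-- `V` decreases towards the heavy points. Outside them both kernels lower it by a fixed amount on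
average, and boundedness of `V` makes the drift geometric. -/
theorem simultaneousGeometricDrift_metropolis {ε : ℝ} (h : Admissible ε) :
    SimultaneousGeometricDrift (metropolis ε h) ({2, 3} : Set State) := by
  have hε := h.pos
  have hlt := h.lt_one
  have hε3 : 0 < ε ^ 3 := by positivity
  have hε1 : ε < 1 := by linarith
  have hw : 0 < (1 - ε - ε ^ 3) / 2 := by linarith
  set m : ℝ := min 1 ((1 - ε - ε ^ 3) / 2 / ε ^ 3) with hm
  have hm0 : 0 < m := lt_min one_pos (div_pos hw hε3)
  set m' : ℝ := min 1 ((1 - ε - ε ^ 3) / 2 / ε) with hm'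
  have hm'0 : 0 < m' := lt_min one_pos (div_pos hw hε)
  have h01 : min 1 (ε ^ 3 / ε) = ε ^ 2 := by
    rw [show ε ^ 3 / ε = ε ^ 2 by field_simp, min_eq_right (by nlinarith)]
  have h10 : min 1 (ε / ε ^ 3) = 1 := by
    refine min_eq_left ?_
    rw [le_div_iff₀ hε3]
    nlinarith [mul_pos hε hε, mul_pos hε (mul_pos hε hε)]
  -- `m` is the acceptance probability from state `1` into the small set. With `m * (A - 1) = 2`,
  -- the expected drop through a proposal into that set outweighs the unit rise at state `0`.
  set A : ℝ := 1 + 2 / m with hA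
  have hmA : m * (1 - A) = -2 := by
    rw [hA]
    field_simp
    ring
  have hA1 : 1 < A := by
    have : 0 < 2 / m := by positivity
    linarith
  let V : State → ℝ := ![A + 1, A, 1, 1]
  have hV (x : State) : V x ∈ Set.Icc 1 (A + 1) := by
    fin_cases x <;> simp [V] <;> linarith
  have hV0 : V 0 = A + 1 := rfl
  have hV1 : V 1 = A := rfl
  have hV2 : V 2 = 1 := rfl
  have hV3 : V 3 = 1 := rfl
  -- The rate `ε ^ 2 / 4` is the probability of the move from state `0` to state `1` under the
  -- second kernel, which lowers `V` by one.
  have hdec (g : Param) (x : State) (hx : x = 0 ∨ x = 1) :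
      transOp ε g V x ≤ V x - ε ^ 2 / 4 := by
    rw [transOp_eq_add_sum_moveProb]
    rcases hx with rfl | rfl <;> fin_cases g <;>
      norm_num [Fin.sum_univ_four, moveProb, proposal, weight_zero, weight_one, weight_two,
        weight_three, hV0, hV1, hV2, hV3, h01, h10, ← hm, ← hm']
    · nlinarith
    · nlinarith
    · nlinarith
    · nlinarith
  -- Since `V ≤ A + 1`, an additive decrease of `ε ^ 2 / 4` is at least `c * V`.
  set c : ℝ := ε ^ 2 / 4 / (A + 1) with hc
  have hc0 : 0 < c := by positivity
  have hcA : c * (A + 1) = ε ^ 2 / 4 := by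
    rw [hc]
    field_simp
  have hc1 : c < 1 := by
    rw [hc, div_lt_one (by linarith)]
    nlinarith
  refine ⟨V, 1 - c, A + 1, measurable_of_finite V, fun x => (hV x).1, by linarith, by linarith,
    fun g x => ?_⟩
  rw [lintegral_metropolis h g x fun y => zero_le_one.trans (hV y).1]
  refine ENNReal.ofReal_le_ofReal ?_
  by_cases hx : x ∈ ({2, 3} : Set State)
  · rw [Set.indicator_of_mem hx]
    have h1 := (transOp_mem_Icc h g hV x).2
    have h2 : 0 ≤ (1 - c) * V x := mul_nonneg (by linarith) (zero_le_one.trans (hV x).1)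
    linarith
  · rw [Set.indicator_of_notMem hx]
    have hx' : x = 0 ∨ x = 1 := by
      revert hx
      fin_cases x <;> simp
    have h1 := hdec g x hx'
    have h2 := mul_le_mul_of_nonneg_left (hV x).2 hc0.le
    linarith

theorem regularAndSmallSet_metropolis {ε : ℝ} (h : Admissible ε) :
    RegularAndSmallSet (target ε h) (metropolis ε h) ({2, 3} : Set State) where
  invariant := invariant_metropolis h
  irreducible := irreducible_metropolis h
  aperiodic := aperiodic_metropolis h
  minorisation := simultaneousMinorisation_metropolis h

/-! ### The chain of pairs, its Markov property, and stationarity at update times -/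

/-- The times at which the parameter is updated. -/
def IsUpdateTime (n : ℕ) : Prop := ∃ k : ℕ, 1 ≤ k ∧ n = 2 ^ (k ^ 2)

open Classical in
/-- The parameter after a move from the pair `s` to the point `y` at time `n`. -/
noncomputable def nextParam (n : ℕ) (s : State × Param) (y : State) : Param :=
  if IsUpdateTime n then adapt s.2 s.1 y else s.2

/-- The transition operator at time `n` of the chain of pairs. -/
noncomputable def stepOp (ε : ℝ) (n : ℕ) (F : State × Param → ℝ) (s : State × Param) : ℝ :=
  ∑ y, transProb ε s.2 s.1 y * F (y, nextParam n s y)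

instance (ε : ℝ) (h : Admissible ε) : IsProbabilityMeasure (chainLaw ε h) := by
  unfold chainLaw
  infer_instance

theorem integral_stepPMF {ε : ℝ} (h : Admissible ε) {n : ℕ} (hn : 2 ≤ n) (s : State × Param)
    (F : State × Param → ℝ) : ∫ t, F t ∂(stepPMF ε h n s).toMeasure = stepOp ε n F s := by
  rw [stepPMF, if_neg (by omega), ← PMF.toMeasure_map _ _ (measurable_of_finite _),
    integral_map (measurable_of_finite _).aemeasurable
      (measurable_of_finite F).aestronglyMeasurable, integral_fintype Integrable.of_finite]
  refine Finset.sum_congr rfl fun y _ => ?_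
  have hy : (metropolisPMF ε h s.2 s.1).toMeasure {y} = ENNReal.ofReal (transProb ε s.2 s.1 y) :=
    metropolis_singleton h s.2 s.1 y
  rw [measureReal_def, hy, ENNReal.toReal_ofReal (transProb_nonneg h _ _ _), smul_eq_mul]
  rfl

/-- The Markov property of the trajectory. -/
theorem integral_chainLaw_step {ε : ℝ} (h : Admissible ε) {n : ℕ} (hn : 2 ≤ n)
    (A : (Finset.Iic n → State × Param) → ℝ) (F : State × Param → State × Param → ℝ) :
    ∫ ω, A (Preorder.frestrictLe n ω) * F (ω n) (ω (n + 1)) ∂(chainLaw ε h) =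
      ∫ ω, A (Preorder.frestrictLe n ω) * stepOp ε n (F (ω n)) (ω n) ∂(chainLaw ε h) := by
  have hmap := Kernel.map_frestrictLe_trajMeasure_compProd_eq_map_trajMeasure
    (X := fun _ => State × Param) (μ₀ := Measure.dirac ((0, 0) : State × Param))
    (κ := stepKernel ε h) (a := n)
  change (chainLaw ε h).map _ ⊗ₘ _ = (chainLaw ε h).map _ at hmap
  have : IsProbabilityMeasure ((chainLaw ε h).map
      (Preorder.frestrictLe (π := fun _ => State × Param) n)) :=
    Measure.isProbabilityMeasure_map (by fun_prop)
  let top : Finset.Iic n := ⟨n, Finset.mem_Iic.2 le_rfl⟩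
  let G : (Finset.Iic n → State × Param) × (State × Param) → ℝ :=
    fun q => A q.1 * F (q.1 top) q.2
  have hG : Measurable G := measurable_of_finite G
  calc ∫ ω, A (Preorder.frestrictLe n ω) * F (ω n) (ω (n + 1)) ∂(chainLaw ε h)
      = ∫ ω, G (Preorder.frestrictLe n ω, ω (n + 1)) ∂(chainLaw ε h) := rfl
    _ = ∫ q, G q ∂((chainLaw ε h).map fun ω => (Preorder.frestrictLe n ω, ω (n + 1))) := by
        rw [integral_map (by fun_prop) hG.aestronglyMeasurable]
    _ = ∫ p, ∫ t, G (p, t) ∂(stepKernel ε h n p)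
          ∂((chainLaw ε h).map (Preorder.frestrictLe n)) := by
        rw [← hmap, Measure.integral_compProd Integrable.of_finite]
    _ = ∫ p, A p * stepOp ε n (F (p top)) (p top)
          ∂((chainLaw ε h).map (Preorder.frestrictLe n)) := by
        refine integral_congr_ae (Eventually.of_forall fun p => ?_)
        simp only [G]
        rw [integral_const_mul]
        congr 1
        exact integral_stepPMF h hn (p top) (F (p top))
    _ = _ := by
        rw [integral_map (by fun_prop) (measurable_of_finite _).aestronglyMeasurable]
        rfl

/-- The expectation of a function of the pair at time `n`. -/
noncomputable def expect (ε : ℝ) (h : Admissible ε) (n : ℕ) (H : State × Param → ℝ) : ℝ :=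
  ∫ ω, H (ω n) ∂(chainLaw ε h)

theorem expect_succ {ε : ℝ} (h : Admissible ε) {n : ℕ} (hn : 2 ≤ n) (H : State × Param → ℝ) :
    expect ε h (n + 1) H = expect ε h n (stepOp ε n H) := by
  simpa [expect] using integral_chainLaw_step h hn (fun _ => 1) (fun _ => H)

theorem integrable_coord {ε : ℝ} (h : Admissible ε) (n : ℕ) (H : State × Param → ℝ) :
    Integrable (fun ω => H (ω n)) (chainLaw ε h) := by
  have hm : Measurable H := measurable_of_finite H
  obtain ⟨s, hs⟩ := Finite.exists_max fun s => |H s|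
  exact Integrable.of_bound (hm.comp (measurable_pi_apply n)).aestronglyMeasurable (|H s|)
    (Eventually.of_forall fun ω => hs (ω n))

theorem expect_sub {ε : ℝ} (h : Admissible ε) (n : ℕ) (H K : State × Param → ℝ) :
    expect ε h n (fun s => H s - K s) = expect ε h n H - expect ε h n K :=
  integral_sub (integrable_coord h n H) (integrable_coord h n K)

theorem expect_const {ε : ℝ} (h : Admissible ε) (n : ℕ) (c : ℝ) :
    expect ε h n (fun _ => c) = c := by
  simp [expect]

theorem expect_mono {ε : ℝ} (h : Admissible ε) (n : ℕ) {H K : State × Param → ℝ}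
    (hle : ∀ s, H s ≤ K s) : expect ε h n H ≤ expect ε h n K :=
  integral_mono (integrable_coord h n H) (integrable_coord h n K) fun ω => hle (ω n)

/-- The bound is crude but does not involve the law at time `n`, about which nothing need be known
at the start of a block. -/
theorem abs_expect_le {ε : ℝ} (h : Admissible ε) (n : ℕ) (H : State × Param → ℝ) :
    |expect ε h n H| ≤ ∑ s, |H s| := by
  have hs (s : State × Param) : |H s| ≤ ∑ s, |H s| :=
    Finset.single_le_sum (f := fun s => |H s|) (fun s _ => abs_nonneg _) (Finset.mem_univ s)
  rw [abs_le]
  constructor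
  · rw [← expect_const h n (-∑ s, |H s|)]
    exact expect_mono h n fun s => (abs_le.1 (hs s)).1
  · rw [← expect_const h n (∑ s, |H s|)]
    exact expect_mono h n fun s => (abs_le.1 (hs s)).2

theorem stepOp_of_not_isUpdateTime (ε : ℝ) {n : ℕ} (hn : ¬ IsUpdateTime n)
    (H : State × Param → ℝ) (s : State × Param) :
    stepOp ε n H s = transOp ε s.2 (fun x => H (x, s.2)) s.1 := by
  simp [stepOp, nextParam, hn, transOp_apply]

/-- Away from the update times the expectations evolve by the iterates of the transition operators
with frozen parameter. -/
theorem expect_add_of_not_isUpdateTime {ε : ℝ} (h : Admissible ε) {a : ℕ} (ha : 2 ≤ a)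
    (H : State × Param → ℝ) (L : ℕ) (hL : ∀ n, a ≤ n → n < a + L → ¬ IsUpdateTime n) :
    expect ε h (a + L) H =
      expect ε h a (fun s => ((transOp ε s.2)^[L] fun x => H (x, s.2)) s.1) := by
  induction L generalizing H with
  | zero => rfl
  | succ L ih =>
    rw [← add_assoc, expect_succ h (by omega), ih _ fun n h1 h2 => hL n h1 (by omega)]
    congr 1
    ext s
    rw [Function.iterate_succ_apply, show (fun x => stepOp ε (a + L) H (x, s.2)) =
      transOp ε s.2 (fun x => H (x, s.2)) from funext fun x =>
        stepOp_of_not_isUpdateTime ε (hL _ (by omega) (by omega)) H (x, s.2)]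

theorem not_isUpdateTime_of_between {k n : ℕ} (h1 : 2 ^ (k ^ 2) < n) (h2 : n < 2 ^ ((k + 1) ^ 2)) :
    ¬ IsUpdateTime n := by
  rintro ⟨j, -, rfl⟩
  have h3 := (Nat.pow_lt_pow_iff_right one_lt_two).1 h1
  have h4 := (Nat.pow_lt_pow_iff_right one_lt_two).1 h2
  have h5 := lt_of_pow_lt_pow_left₀ 2 (Nat.zero_le _) h3
  have h6 := lt_of_pow_lt_pow_left₀ 2 (Nat.zero_le _) h4
  omega

/-- At the update times the position is asymptotically stationary given the parameter. -/
theorem tendsto_expect_update {ε : ℝ} (h : Admissible ε) {H : State × Param → ℝ}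
    (hH : ∀ g, mean ε (fun x => H (x, g)) = 0) :
    Tendsto (fun k : ℕ => expect ε h (2 ^ (k ^ 2)) H) atTop (𝓝 0) := by
  rw [← tendsto_add_atTop_iff_nat 2]
  -- The number of steps with frozen parameter, from just after one update time to the next. The
  -- shift of `k` by two makes the earlier one a genuine update time.
  let L : ℕ → ℕ := fun k => 2 ^ ((k + 2) ^ 2) - (2 ^ ((k + 1) ^ 2) + 1)
  have hlt (k : ℕ) : 2 ^ ((k + 1) ^ 2) + 1 + k ≤ 2 ^ ((k + 2) ^ 2) := by
    have h1 : k < 2 ^ ((k + 1) ^ 2) := by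
      have := (Nat.lt_two_pow_self (n := (k + 1) ^ 2))
      nlinarith
    have h2 : 2 ^ ((k + 1) ^ 2) * 2 ≤ 2 ^ ((k + 2) ^ 2) := by
      rw [← pow_succ]
      exact Nat.pow_le_pow_right (by norm_num) (by nlinarith)
    omega
  have hLk (k : ℕ) : 2 ^ ((k + 2) ^ 2) = 2 ^ ((k + 1) ^ 2) + 1 + L k := by
    have := hlt k
    simp only [L]
    omega
  have hLtop : Tendsto L atTop atTop := by
    refine tendsto_atTop_mono (fun k => ?_) tendsto_id
    have := hlt k
    simp only [L, id]
    omega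
  have hbound (k : ℕ) : ‖expect ε h (2 ^ ((k + 2) ^ 2)) H‖ ≤
      ∑ s : State × Param, |((transOp ε s.2)^[L k] fun x => H (x, s.2)) s.1| := by
    rw [hLk, expect_add_of_not_isUpdateTime h]
    · exact abs_expect_le h _ _
    · have : 1 ≤ 2 ^ ((k + 1) ^ 2) := Nat.one_le_two_pow
      omega
    · intro n h1 h2
      rw [← hLk] at h2
      exact not_isUpdateTime_of_between (k := k + 1) (by omega) h2
  refine squeeze_zero_norm hbound ?_
  rw [← Finset.sum_const_zero (s := (Finset.univ : Finset (State × Param)))]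
  refine tendsto_finsetSum _ fun s _ => ?_
  have := ((tendsto_transOp_iterate h s.2 (fun x => H (x, s.2)) s.1).comp hLtop).abs
  rwa [hH, abs_zero] at this

/-! ### Bias two steps after an update, and failure of convergence -/

/-- The expected indicator of the first point two steps after an update time. -/
noncomputable def twoStep (ε : ℝ) (s : State × Param) : ℝ :=
  ∑ y, transProb ε s.2 s.1 y * transProb ε (adapt s.2 s.1 y) y 0

theorem expect_two_steps_after_update {ε : ℝ} (h : Admissible ε) {k : ℕ} (hk : 1 ≤ k) :
    expect ε h (2 ^ (k ^ 2) + 2) (fun s => if s.1 = 0 then 1 else 0) =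
      expect ε h (2 ^ (k ^ 2)) (twoStep ε) := by
  have hk2 : k ^ 2 ≠ 0 := by positivity
  have h2 : 2 ≤ 2 ^ (k ^ 2) := Nat.le_self_pow hk2 2
  have hup : IsUpdateTime (2 ^ (k ^ 2)) := ⟨k, hk, rfl⟩
  -- The indicator ignores the parameter, so only the update at time `2 ^ (k ^ 2)` affects the
  -- result.
  rw [expect_succ h (n := 2 ^ (k ^ 2) + 1) (by omega), expect_succ h h2]
  congr 1
  ext s
  simp [twoStep, stepOp, nextParam, hup]

theorem mean_transProb_zero {ε : ℝ} (h : Admissible ε) (g : Param) :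
    mean ε (fun x => transProb ε g x 0) = ε := by
  have hrow (x : State) : weight ε x * transProb ε g x 0 = ε * transProb ε g 0 x := by
    rw [detailed_balance h, weight_zero]
  rw [mean_apply]
  simp only [hrow]
  rw [← Finset.mul_sum, sum_transProb, mul_one]

/-- The second kernel follows the first unless the chain held, so the correction to the plain
composition sits on the diagonal. -/
theorem twoStep_zero (ε : ℝ) (x : State) :
    twoStep ε (x, 0) = transOp ε 0 (fun y => transProb ε 1 y 0) x +
      transProb ε 0 x x * (transProb ε 0 x 0 - transProb ε 1 x 0) := by
  rw [transOp_apply, twoStep, ← Finset.add_sum_erase _ _ (Finset.mem_univ x),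
    ← Finset.add_sum_erase _ (fun y => transProb ε 0 x y * transProb ε 1 y 0) (Finset.mem_univ x),
    Finset.sum_congr rfl (g := fun y => transProb ε 0 x y * transProb ε 1 y 0) fun y hy => by
      simp [adapt, Finset.ne_of_mem_erase hy]]
  simp only [adapt, if_true, ne_eq, not_true_eq_false, if_false]
  ring

/-- Here the second kernel is used twice unless the first move ends at state `0`, so only that term
is corrected. -/
theorem twoStep_one (ε : ℝ) (x : State) :
    twoStep ε (x, 1) = transOp ε 1 (fun y => transProb ε 1 y 0) x +
      transProb ε 1 x 0 * (transProb ε 0 0 0 - transProb ε 1 0 0) := by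
  simp only [transOp_apply, twoStep, Fin.sum_univ_four, adapt]
  norm_num
  simp
  ring

theorem transProb_of_ne (ε : ℝ) (g : Param) {x y : State} (hyx : y ≠ x) :
    transProb ε g x y = moveProb ε g x y := by
  simp [transProb, hyx]

theorem transProb_self (ε : ℝ) (g : Param) (x : State) :
    transProb ε g x x = 1 - ∑ y, moveProb ε g x y := by
  have : moveProb ε g x x = 0 := by simp [moveProb, proposal]
  rw [← Finset.add_sum_erase _ _ (Finset.mem_univ x), this, zero_add]
  simp [transProb]

/-- By invariance the uncorrected composition has mean `ε`, so the correction's mean must be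
positive. From parameter `1` it is `ε * (1 / 4 - ε ^ 2 / 4)`. From parameter `0`, state `0`
contributes more than `ε / 8`, state `1` a nonnegative amount, state `2` at least `-ε / 8`, and
state `3` nothing. -/
theorem lt_mean_twoStep {ε : ℝ} (h : Admissible ε) (hlt : ε < 1 / 4) (g : Param) :
    ε < mean ε (fun x => twoStep ε (x, g)) := by
  have hε := h.pos
  have hsq : ε ^ 2 < 1 / 16 := by nlinarith
  have hcu : ε ^ 3 < 1 / 64 := by nlinarith
  have hcu0 : 0 < ε ^ 3 := by positivity
  have hw : 0 < (1 - ε - ε ^ 3) / 2 := by linarith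
  have h01 : min 1 (ε ^ 3 / ε) = ε ^ 2 := by
    rw [show ε ^ 3 / ε = ε ^ 2 by field_simp, min_eq_right (by linarith)]
  have h10 : min 1 (ε / ε ^ 3) = 1 := by
    refine min_eq_left ?_
    rw [le_div_iff₀ hcu0]
    nlinarith
  have h02 : min 1 ((1 - ε - ε ^ 3) / 2 / ε) = 1 := by
    refine min_eq_left ?_
    rw [le_div_iff₀ hε]
    linarith
  have h20 : min 1 (ε / ((1 - ε - ε ^ 3) / 2)) = ε / ((1 - ε - ε ^ 3) / 2) := by
    refine min_eq_right ?_
    rw [div_le_one hw]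
    linarith
  have a00 : transProb ε 0 0 0 = 1 - ε ^ 2 / 2 := by
    norm_num [transProb_self, Fin.sum_univ_four, moveProb, proposal, weight_zero, weight_one,
      weight_two, weight_three, h01, h02]
    ring
  have b00 : transProb ε 1 0 0 = 3 / 4 - ε ^ 2 / 4 := by
    norm_num [transProb_self, Fin.sum_univ_four, moveProb, proposal, weight_zero, weight_one,
      weight_two, weight_three, h01, h02]
    ring
  have hmean (u : State → ℝ) : mean ε u = ε * u 0 + ε ^ 3 * u 1 +
      (1 - ε - ε ^ 3) / 2 * u 2 + (1 - ε - ε ^ 3) / 2 * u 3 := by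
    rw [mean_apply, Fin.sum_univ_four]
    rfl
  have hsplit {u v w : State → ℝ} (hu : ∀ x, u x = v x + w x) :
      mean ε u = mean ε v + mean ε w := by
    rw [← map_add]
    exact congrArg _ (funext hu)
  rcases (show g = 0 ∨ g = 1 by revert g; decide) with rfl | rfl
  · rw [hsplit (twoStep_zero ε), mean_transOp h, mean_transProb_zero h, hmean]
    have a10 : transProb ε 0 1 0 = 1 / 2 := by
      rw [transProb_of_ne _ _ (by decide)]
      norm_num [moveProb, proposal, weight_zero, weight_one, h10]
    have b10 : transProb ε 1 1 0 = 1 / 4 := by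
      rw [transProb_of_ne _ _ (by decide)]
      norm_num [moveProb, proposal, weight_zero, weight_one, h10]
    have a20 : transProb ε 0 2 0 = 0 := by
      rw [transProb_of_ne _ _ (by decide)]
      norm_num [moveProb, proposal]
    have b20 : transProb ε 1 2 0 = 1 / 4 * (ε / ((1 - ε - ε ^ 3) / 2)) := by
      rw [transProb_of_ne _ _ (by decide)]
      norm_num [moveProb, proposal, weight_zero, weight_two, h20]
    have a30 : transProb ε 0 3 0 = 0 := by
      rw [transProb_of_ne _ _ (by decide)]
      norm_num [moveProb, proposal]
    have b30 : transProb ε 1 3 0 = 0 := by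
      rw [transProb_of_ne _ _ (by decide)]
      norm_num [moveProb, proposal]
    have a23 : transProb ε 0 2 3 = 1 / 2 := by
      rw [transProb_of_ne _ _ (by decide)]
      norm_num [moveProb, proposal, weight_two, weight_three, hw.ne']
    -- The two heavy points have equal weight, so a proposal from one to the other is always
    -- accepted and at most half of the mass can hold.
    have a22 : transProb ε 0 2 2 ≤ 1 / 2 := by
      have hs := sum_transProb ε 0 2
      rw [Fin.sum_univ_four, a23] at hs
      linarith [transProb_nonneg h 0 2 0, transProb_nonneg h 0 2 1]
    have a11 := transProb_nonneg h 0 1 1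
    have hcancel : (1 - ε - ε ^ 3) / 2 * (ε / ((1 - ε - ε ^ 3) / 2)) = ε :=
      mul_div_cancel₀ _ hw.ne'
    rw [a00, b00, a10, b10, a20, b20, a30, b30]
    have e1 : 0 ≤ ε ^ 3 * (transProb ε 0 1 1 * (1 / 2 - 1 / 4)) := by positivity
    have e2 : (1 - ε - ε ^ 3) / 2 *
        (transProb ε 0 2 2 * (0 - 1 / 4 * (ε / ((1 - ε - ε ^ 3) / 2)))) =
        -(1 / 4) * ε * transProb ε 0 2 2 := by
      linear_combination (-(1 / 4) * transProb ε 0 2 2) * hcancel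
    rw [e2]
    have e3 : ε * (1 / 8) < ε * ((1 - ε ^ 2 / 2) *
        (1 - ε ^ 2 / 2 - (3 / 4 - ε ^ 2 / 4))) := by
      refine mul_lt_mul_of_pos_left ?_ hε
      nlinarith
    nlinarith
  · rw [hsplit (twoStep_one ε), mean_transOp h, mean_transProb_zero h]
    have hc : mean ε (fun x => transProb ε 1 x 0 * (transProb ε 0 0 0 - transProb ε 1 0 0)) =
        ε * (transProb ε 0 0 0 - transProb ε 1 0 0) := by
      rw [mean_apply]
      simp only [← mul_assoc]
      rw [← Finset.sum_mul, ← mean_apply, mean_transProb_zero h]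
    rw [hc, a00, b00]
    nlinarith

theorem not_convergesInDistribution_chain {ε : ℝ} (h : Admissible ε) (hlt : ε < 1 / 4) :
    ¬ ConvergesInDistribution (chainLaw ε h) chain := by
  rintro ⟨ν, hν, hconv⟩
  set I : State × Param → ℝ := fun s => if s.1 = 0 then 1 else 0 with hI
  have hlim : Tendsto (fun n => expect ε h n I) atTop (𝓝 (ν.real {0})) := by
    have hprob (n : ℕ) : expect ε h n I = (chainLaw ε h (chain n ⁻¹' {0})).toReal := by
      have hm : MeasurableSet (chain n ⁻¹' {0}) :=
        (measurable_fst.comp (measurable_pi_apply n)) (measurableSet_singleton _)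
      rw [← measureReal_def, ← integral_indicator_one hm]
      refine integral_congr_ae (Eventually.of_forall fun ω => ?_)
      by_cases hx : (ω n).1 = 0
      · rw [Set.indicator_of_mem (show ω ∈ chain n ⁻¹' {0} from hx)]
        simp [hI, hx]
      · rw [Set.indicator_of_notMem (show ω ∉ chain n ⁻¹' {0} from hx)]
        simp [hI, hx]
    simp only [hprob]
    exact (ENNReal.tendsto_toReal (measure_ne_top ν _)).comp
      (hconv {0} (measurableSet_singleton _))
  have hupd : Tendsto (fun k : ℕ => 2 ^ (k ^ 2)) atTop (atTop : Filter ℕ) := by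
    refine tendsto_atTop_mono (fun k => ?_) tendsto_id
    have := Nat.lt_two_pow_self (n := k ^ 2)
    simp only [id]
    nlinarith
  -- The centred indicator has stationary mean zero, so the update times identify the only possible
  -- limit.
  have hεν : ν.real {0} = ε := by
    have h1 := tendsto_expect_update h (H := fun s => I s - ε) fun g => by
      have : (fun x => I (x, g) - ε) = (fun x => if x = 0 then 1 else 0) - fun _ => ε := rfl
      rw [this, map_sub, mean_const, mean_apply]
      simp [weight_zero]
    simp only [expect_sub, expect_const] at h1
    have h2 := (hlim.comp hupd).sub_const ε
    linarith [tendsto_nhds_unique h2 h1]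
  let m : Param → ℝ := fun g => mean ε (fun x => twoStep ε (x, g))
  obtain ⟨g₀, hg₀⟩ := Finite.exists_min m
  have h3 := tendsto_expect_update h (H := fun s => twoStep ε s - m s.2) fun g => by
    have : (fun x => twoStep ε (x, g) - m g) = (fun x => twoStep ε (x, g)) - fun _ => m g := rfl
    rw [this, map_sub, mean_const]
    exact sub_self _
  simp only [expect_sub] at h3
  have h4 : Tendsto (fun k : ℕ => expect ε h (2 ^ (k ^ 2)) (twoStep ε)) atTop (𝓝 (ν.real {0})) := by
    refine (hlim.comp ((tendsto_add_atTop_nat 2).comp hupd)).congr' ?_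
    filter_upwards [eventually_ge_atTop 1] with k hk
    exact expect_two_steps_after_update h hk
  have h5 : m g₀ ≤ ν.real {0} - 0 := by
    refine ge_of_tendsto' (h4.sub h3) fun k => ?_
    have := expect_mono h (2 ^ (k ^ 2)) (H := fun _ => m g₀) (K := fun s => m s.2) fun s => hg₀ s.2
    rw [expect_const] at this
    linarith
  have h6 : ε < m g₀ := lt_mean_twoStep h hlt g₀
  linarith

/-! ### A strong law for bounded orthogonal variables -/

theorem integral_sq_sum_le_of_orthogonal {Ω : Type*} [MeasurableSpace Ω] {μ : Measure Ω}
    [IsProbabilityMeasure μ] {d : ℕ → Ω → ℝ} {C : ℝ} (hm : ∀ i, Measurable (d i))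
    (hb : ∀ i ω, |d i ω| ≤ C) (horth : ∀ i j, i < j → ∫ ω, d i ω * d j ω ∂μ = 0) (N : ℕ) :
    ∫ ω, (∑ i ∈ Finset.range N, d i ω) ^ 2 ∂μ ≤ N * C ^ 2 := by
  have hint (i j : ℕ) : Integrable (fun ω => d i ω * d j ω) μ := by
    refine Integrable.of_bound ((hm i).mul (hm j)).aestronglyMeasurable (C * C)
      (Eventually.of_forall fun ω => ?_)
    rw [norm_mul]
    exact mul_le_mul (hb i ω) (hb j ω) (norm_nonneg _) ((abs_nonneg _).trans (hb i ω))
  have hcross (N j : ℕ) : Integrable (fun ω => (∑ i ∈ Finset.range N, d i ω) * d j ω) μ := by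
    simp only [Finset.sum_mul]
    exact integrable_finsetSum _ fun i _ => hint i j
  have hsq (N : ℕ) : Integrable (fun ω => (∑ i ∈ Finset.range N, d i ω) ^ 2) μ := by
    simp only [pow_two, Finset.mul_sum]
    exact integrable_finsetSum _ fun j _ => hcross N j
  induction N with
  | zero => simp
  | succ N ih =>
    have hexp (ω : Ω) : (∑ i ∈ Finset.range (N + 1), d i ω) ^ 2 =
        (∑ i ∈ Finset.range N, d i ω) ^ 2 + 2 * ((∑ i ∈ Finset.range N, d i ω) * d N ω) +
          d N ω * d N ω := by
      rw [Finset.sum_range_succ]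
      ring
    have hzero : ∫ ω, (∑ i ∈ Finset.range N, d i ω) * d N ω ∂μ = 0 := by
      simp only [Finset.sum_mul]
      rw [integral_finsetSum _ fun i _ => hint i N]
      exact Finset.sum_eq_zero fun i hi => horth i N (Finset.mem_range.1 hi)
    have hlast : ∫ ω, d N ω * d N ω ∂μ ≤ C ^ 2 := by
      calc ∫ ω, d N ω * d N ω ∂μ ≤ ∫ _, C ^ 2 ∂μ := by
            refine integral_mono (hint N N) (integrable_const _) fun ω => ?_
            rw [← pow_two]
            exact sq_le_sq' (abs_le.1 (hb N ω)).1 (abs_le.1 (hb N ω)).2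
        _ = C ^ 2 := by simp
    simp only [hexp]
    have hadd : Integrable (fun ω => (∑ i ∈ Finset.range N, d i ω) ^ 2 +
        2 * ((∑ i ∈ Finset.range N, d i ω) * d N ω)) μ := (hsq N).add ((hcross N N).const_mul 2)
    rw [integral_add hadd (hint N N), integral_add (hsq N) ((hcross N N).const_mul 2),
      integral_const_mul, hzero]
    push_cast
    linarith

/-- Averages with bounded increments vanish as soon as they vanish along the squares. -/
theorem tendsto_average_of_tendsto_squares {d : ℕ → ℝ} {C : ℝ} (hb : ∀ i, |d i| ≤ C)
    (hsq : Tendsto (fun m : ℕ => (∑ i ∈ Finset.range (m ^ 2), d i) / (m : ℝ) ^ 2) atTop (𝓝 0)) :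
    Tendsto (fun N : ℕ => (1 / (N : ℝ)) * ∑ i ∈ Finset.range N, d i) atTop (𝓝 0) := by
  have hC : 0 ≤ C := (abs_nonneg _).trans (hb 0)
  have hsqrt : Tendsto Nat.sqrt atTop atTop := by
    refine tendsto_atTop_atTop.2 fun b => ⟨b ^ 2, fun a ha => ?_⟩
    exact Nat.le_sqrt'.2 ha
  have hlim : Tendsto (fun m : ℕ => |(∑ i ∈ Finset.range (m ^ 2), d i) / (m : ℝ) ^ 2| +
      2 * C / m) atTop (𝓝 0) := by
    simpa using hsq.abs.add (tendsto_const_div_atTop_nhds_zero_nat (2 * C))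
  refine squeeze_zero_norm' ?_ (hlim.comp hsqrt)
  filter_upwards [eventually_ge_atTop 1] with N hN
  simp only [Function.comp_apply]
  set m := Nat.sqrt N with hm
  have h1 : m ^ 2 ≤ N := Nat.sqrt_le' N
  -- Fewer than `2 * m + 1` terms lie beyond the last square, so they contribute `O(1 / m)` to the
  -- average.
  have h2 : N ≤ m ^ 2 + 2 * m := by
    have := Nat.sqrt_le_add N
    rw [← hm] at this
    nlinarith
  have hm1 : 1 ≤ m := Nat.le_sqrt'.2 (by simpa using hN)
  have hm0 : (0 : ℝ) < m := by exact_mod_cast hm1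
  have hN2 : ((m : ℝ)) ^ 2 ≤ N := by exact_mod_cast h1
  have hrest : |∑ i ∈ Finset.Ico (m ^ 2) N, d i| ≤ 2 * m * C := by
    calc |∑ i ∈ Finset.Ico (m ^ 2) N, d i| ≤ ∑ i ∈ Finset.Ico (m ^ 2) N, |d i| :=
          Finset.abs_sum_le_sum_abs _ _
      _ ≤ ∑ i ∈ Finset.Ico (m ^ 2) N, C := Finset.sum_le_sum fun i _ => hb i
      _ = (N - m ^ 2 : ℕ) * C := by simp
      _ ≤ 2 * m * C := by
          refine mul_le_mul_of_nonneg_right ?_ hC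
          exact_mod_cast (by omega : N - m ^ 2 ≤ 2 * m)
  have hsum : |∑ i ∈ Finset.range N, d i| ≤ |∑ i ∈ Finset.range (m ^ 2), d i| + 2 * m * C := by
    rw [← Finset.sum_range_add_sum_Ico _ h1]
    exact (abs_add_le _ _).trans (by linarith)
  rw [Real.norm_eq_abs, abs_mul, abs_of_nonneg (by positivity), one_div_mul_eq_div]
  calc |∑ i ∈ Finset.range N, d i| / N
      ≤ (|∑ i ∈ Finset.range (m ^ 2), d i| + 2 * m * C) / (m : ℝ) ^ 2 :=
        div_le_div₀ (by positivity) hsum (by positivity) hN2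
    _ = _ := by
        rw [abs_div, abs_of_pos (pow_pos hm0 2)]
        field_simp

/-- A strong law of large numbers for bounded pairwise orthogonal variables. -/
theorem ae_tendsto_average_of_orthogonal {Ω : Type*} [MeasurableSpace Ω] {μ : Measure Ω}
    [IsProbabilityMeasure μ] {d : ℕ → Ω → ℝ} {C : ℝ} (hm : ∀ i, Measurable (d i))
    (hb : ∀ i ω, |d i ω| ≤ C) (horth : ∀ i j, i < j → ∫ ω, d i ω * d j ω ∂μ = 0) :
    ∀ᵐ ω ∂μ, Tendsto (fun N : ℕ => (1 / (N : ℝ)) * ∑ i ∈ Finset.range N, d i ω) atTop (𝓝 0) := by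
  let Y : ℕ → Ω → ℝ := fun m ω => (∑ i ∈ Finset.range (m ^ 2), d i ω) / (m : ℝ) ^ 2
  have hY (m : ℕ) : Measurable (Y m) :=
    (Finset.measurable_sum _ fun i _ => hm i).div_const _
  have hYb (m : ℕ) (ω : Ω) : |Y m ω| ≤ C := by
    have hC : 0 ≤ C := (abs_nonneg _).trans (hb 0 ω)
    simp only [Y]
    rw [abs_div, abs_of_nonneg (by positivity : (0 : ℝ) ≤ (m : ℝ) ^ 2)]
    refine div_le_of_le_mul₀ (by positivity) hC ?_
    calc |∑ i ∈ Finset.range (m ^ 2), d i ω| ≤ ∑ i ∈ Finset.range (m ^ 2), |d i ω| :=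
          Finset.abs_sum_le_sum_abs _ _
      _ ≤ ∑ i ∈ Finset.range (m ^ 2), C := Finset.sum_le_sum fun i _ => hb i ω
      _ = C * (m : ℝ) ^ 2 := by
          simp
          ring
  have hint (m : ℕ) : Integrable (fun ω => Y m ω ^ 2) μ := by
    refine Integrable.of_bound ((hY m).pow_const 2).aestronglyMeasurable (C ^ 2)
      (Eventually.of_forall fun ω => ?_)
    rw [Real.norm_eq_abs, abs_pow]
    exact pow_le_pow_left₀ (abs_nonneg _) (hYb m ω) 2
  have hmom (m : ℕ) : ∫ ω, Y m ω ^ 2 ∂μ ≤ C ^ 2 * (1 / (m : ℝ) ^ 2) := by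
    simp only [Y, div_pow]
    rw [integral_div]
    have := integral_sq_sum_le_of_orthogonal hm hb horth (m ^ 2)
    rcases Nat.eq_zero_or_pos m with rfl | hm0
    · simp
    · have hm0' : (0 : ℝ) < m := by exact_mod_cast hm0
      rw [div_le_iff₀ (by positivity)]
      refine this.trans (le_of_eq ?_)
      push_cast
      field_simp
  -- Along the squares the second moments are summable, so by Tonelli the sum of the `Y m ω ^ 2` is
  -- almost surely finite and its terms tend to zero.
  have hsum : Summable fun m : ℕ => C ^ 2 * (1 / (m : ℝ) ^ 2) :=
    (Real.summable_one_div_nat_pow.2 one_lt_two).mul_left _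
  have hfin : ∑' m, ∫⁻ ω, ENNReal.ofReal (Y m ω ^ 2) ∂μ ≠ ⊤ := by
    refine ne_top_of_le_ne_top hsum.tsum_ofReal_ne_top (ENNReal.tsum_le_tsum fun m => ?_)
    rw [← ofReal_integral_eq_lintegral_ofReal (hint m)
      (Eventually.of_forall fun ω => sq_nonneg _)]
    exact ENNReal.ofReal_le_ofReal (hmom m)
  have hmeas (m : ℕ) : Measurable fun ω => ENNReal.ofReal (Y m ω ^ 2) :=
    ((hY m).pow_const 2).ennreal_ofReal
  rw [← lintegral_tsum fun m => (hmeas m).aemeasurable] at hfin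
  filter_upwards [ae_lt_top (Measurable.tsum hmeas) hfin] with ω hω
  refine tendsto_average_of_tendsto_squares (fun i => hb i ω) ?_
  have h1 := ENNReal.tendsto_atTop_zero_of_tsum_ne_top hω.ne
  have h2 := (ENNReal.tendsto_toReal ENNReal.zero_ne_top).comp h1
  simp only [Function.comp_def, ENNReal.toReal_ofReal (sq_nonneg _), ENNReal.toReal_zero] at h2
  have h3 := h2.sqrt
  simp only [Real.sqrt_sq_eq_abs, Real.sqrt_zero] at h3
  exact (tendsto_zero_iff_abs_tendsto_zero _).2 h3

/-! ### Sparse exceptional times and telescoping averages -/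

/-- A set of times that contains all update times and the first two times. -/
def IsExceptionalTime (n : ℕ) : Prop := n = 0 ∨ ∃ k : ℕ, n = 2 ^ k

theorem IsUpdateTime.isExceptionalTime {n : ℕ} (hn : IsUpdateTime n) : IsExceptionalTime n :=
  Or.inr (hn.imp' (· ^ 2) fun _ hk => hk.2)

theorem two_le_of_not_isExceptionalTime {n : ℕ} (hn : ¬ IsExceptionalTime n) : 2 ≤ n := by
  by_contra hlt
  obtain rfl | rfl : n = 0 ∨ n = 1 := by omega
  · exact hn (Or.inl rfl)
  · exact hn (Or.inr ⟨0, rfl⟩)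

open Classical in
theorem card_exceptional_le (N : ℕ) :
    ((Finset.range N).filter IsExceptionalTime).card ≤ Nat.log 2 N + 2 := by
  have hsub : (Finset.range N).filter IsExceptionalTime ⊆
      insert 0 ((Finset.range (Nat.log 2 N + 1)).image (2 ^ ·)) := by
    intro n hn
    obtain ⟨hlt, rfl | ⟨k, rfl⟩⟩ := Finset.mem_filter.1 hn
    · exact Finset.mem_insert_self _ _
    · refine Finset.mem_insert_of_mem (Finset.mem_image_of_mem _ (Finset.mem_range.2 ?_))
      have h1 : 2 ^ k ≤ N := (Finset.mem_range.1 hlt).le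
      exact Nat.lt_succ_of_le (Nat.le_log_of_pow_le one_lt_two h1)
  calc _ ≤ _ := Finset.card_le_card hsub
    _ ≤ _ := Finset.card_insert_le _ _
    _ ≤ (Nat.log 2 N + 1) + 1 := by
        have := Finset.card_image_le (s := Finset.range (Nat.log 2 N + 1)) (f := (2 ^ ·))
        simp only [Finset.card_range] at this
        omega

theorem tendsto_log_two_div : Tendsto (fun N : ℕ => ((Nat.log 2 N : ℕ) : ℝ) / N) atTop (𝓝 0) := by
  have h1 : Tendsto (fun N : ℕ => Real.log N / N / Real.log 2) atTop (𝓝 0) := by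
    have := (Real.isLittleO_log_id_atTop.tendsto_div_nhds_zero).comp
      (tendsto_natCast_atTop_atTop (R := ℝ))
    simpa using this.div_const (Real.log 2)
  refine squeeze_zero (fun N => by positivity) (fun N => ?_) h1
  have h2 : ((Nat.log 2 N : ℕ) : ℝ) ≤ Real.logb 2 N := Real.natLog_le_logb N 2
  rw [div_right_comm]
  exact div_le_div_of_nonneg_right h2 (by positivity)

/-- A bounded sequence that vanishes off the exceptional times, up to a bounded telescoping sum, has
vanishing averages. -/
theorem tendsto_average_of_telescoping {e w : ℕ → ℝ} {C : ℝ} (he : ∀ i, |e i| ≤ C)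
    (hw : ∀ i, |w i| ≤ C) (hew : ∀ i, ¬ IsExceptionalTime i → e i = w i - w (i + 1)) :
    Tendsto (fun N : ℕ => (1 / (N : ℝ)) * ∑ i ∈ Finset.range N, e i) atTop (𝓝 0) := by
  classical
  have hC : 0 ≤ C := (abs_nonneg _).trans (he 0)
  have hbound (N : ℕ) : |∑ i ∈ Finset.range N, e i| ≤ 2 * C + (Nat.log 2 N + 2 : ℕ) * (3 * C) := by
    -- The full sum of increments of `w` telescopes; the error is supported on exceptional times,
    -- each costing at most `3 * C`.
    have htel : ∑ i ∈ Finset.range N, e i =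
        (w 0 - w N) + ∑ i ∈ (Finset.range N).filter IsExceptionalTime,
          (e i - (w i - w (i + 1))) := by
      rw [Finset.sum_filter_of_ne, Finset.sum_sub_distrib, Finset.sum_range_sub']
      · ring
      · intro i _ hi
        by_contra hn
        exact hi (by rw [hew i hn, sub_self])
    have hexc : |∑ i ∈ (Finset.range N).filter IsExceptionalTime, (e i - (w i - w (i + 1)))| ≤
        (Nat.log 2 N + 2 : ℕ) * (3 * C) := by
      calc _ ≤ ∑ i ∈ (Finset.range N).filter IsExceptionalTime, |e i - (w i - w (i + 1))| :=
            Finset.abs_sum_le_sum_abs _ _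
        _ ≤ ∑ i ∈ (Finset.range N).filter IsExceptionalTime, 3 * C := by
            refine Finset.sum_le_sum fun i _ => ?_
            have h1 := abs_le.1 (he i)
            have h2 := abs_le.1 (hw i)
            have h3 := abs_le.1 (hw (i + 1))
            rw [abs_le]
            constructor <;> linarith
        _ ≤ _ := by
            rw [Finset.sum_const, nsmul_eq_mul]
            refine mul_le_mul_of_nonneg_right ?_ (by positivity)
            exact_mod_cast card_exceptional_le N
    rw [htel]
    refine (abs_add_le _ _).trans (add_le_add ?_ hexc)
    have h2 := abs_le.1 (hw 0)
    have h3 := abs_le.1 (hw N)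
    rw [abs_le]
    constructor <;> linarith
  have hlim : Tendsto (fun N : ℕ => 8 * C / N + 3 * C * (((Nat.log 2 N : ℕ) : ℝ) / N)) atTop
      (𝓝 0) := by
    simpa using (tendsto_const_div_atTop_nhds_zero_nat (8 * C)).add
      (tendsto_log_two_div.const_mul (3 * C))
  refine squeeze_zero_norm (fun N => ?_) hlim
  rw [Real.norm_eq_abs, abs_mul, abs_of_nonneg (by positivity), one_div_mul_eq_div]
  calc _ ≤ (2 * C + (Nat.log 2 N + 2 : ℕ) * (3 * C)) / N :=
        div_le_div_of_nonneg_right (hbound N) (by positivity)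
    _ = _ := by
        push_cast
        ring

/-! ### Martingale decomposition and the strong law for the chain -/

/-- The martingale differences attached to a family `u` of functions: the deviation of `u` at time
`n + 1` from its conditional expectation given the past. -/
noncomputable def martDiff (ε : ℝ) (u : Param → State → ℝ) (s t : State × Param) : ℝ :=
  u s.2 t.1 - transOp ε s.2 (u s.2) s.1

/-- The martingale differences along the trajectory, from time `2` on. -/
noncomputable def martDiffSeq (ε : ℝ) (u : Param → State → ℝ) (n : ℕ) (ω : ℕ → State × Param) : ℝ :=
  if 2 ≤ n then martDiff ε u (ω n) (ω (n + 1)) else 0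

/-- This holds at update times too: `martDiff` uses the parameter that drew the move and only the
position reached, never the new parameter. -/
theorem stepOp_martDiff (ε : ℝ) (u : Param → State → ℝ) (n : ℕ) (s : State × Param) :
    stepOp ε n (martDiff ε u s) s = 0 := by
  simp only [stepOp, martDiff, mul_sub, Finset.sum_sub_distrib, ← Finset.sum_mul, sum_transProb]
  rw [one_mul, ← transOp_apply, sub_self]

/-- The earlier difference is a function of the history up to time `j`, given which the later one
has mean zero. -/
theorem martDiffSeq_orthogonal {ε : ℝ} (h : Admissible ε) (u : Param → State → ℝ) {i j : ℕ}
    (hij : i < j) :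
    ∫ ω, martDiffSeq ε u i ω * martDiffSeq ε u j ω ∂(chainLaw ε h) = 0 := by
  by_cases hj : 2 ≤ j
  · let A : (Finset.Iic j → State × Param) → ℝ := fun p =>
      if 2 ≤ i then martDiff ε u (p ⟨i, Finset.mem_Iic.2 hij.le⟩)
        (p ⟨i + 1, Finset.mem_Iic.2 hij⟩) else 0
    have hstep := integral_chainLaw_step h hj A (martDiff ε u)
    simp only [stepOp_martDiff, mul_zero, integral_zero] at hstep
    rw [← hstep]
    refine integral_congr_ae (Eventually.of_forall fun ω => ?_)
    simp only [martDiffSeq, if_pos hj]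
    rfl
  · simp [martDiffSeq, hj]

theorem measurable_pair (n : ℕ) :
    Measurable fun ω : ℕ → State × Param => (ω n, ω (n + 1)) :=
  (measurable_pi_apply n).prodMk (measurable_pi_apply (n + 1))

/-- Almost surely the parameter is kept at all times that are not update times. -/
theorem ae_param_eq {ε : ℝ} (h : Admissible ε) {n : ℕ} (hn : 2 ≤ n) (hup : ¬ IsUpdateTime n) :
    ∀ᵐ ω ∂(chainLaw ε h), (ω (n + 1)).2 = (ω n).2 := by
  -- `F` indicates a change of parameter; it is nonnegative with zero expectation, hence almost
  -- surely zero.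
  let F : State × Param → State × Param → ℝ := fun s t => if t.2 = s.2 then 0 else 1
  have hF : Measurable fun q : (State × Param) × (State × Param) => F q.1 q.2 :=
    measurable_of_finite _
  have hstep (s : State × Param) : stepOp ε n (F s) s = 0 := by
    simp [stepOp, nextParam, hup, F]
  have hzero := integral_chainLaw_step h hn (fun _ => 1) F
  simp only [one_mul, hstep, integral_zero] at hzero
  have hF0 (s t : State × Param) : 0 ≤ F s t := by
    simp only [F]
    split_ifs <;> norm_num
  have hF1 (s t : State × Param) : F s t ≤ 1 := by
    simp only [F]
    split_ifs <;> norm_num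
  have hint : Integrable (fun ω => F (ω n) (ω (n + 1))) (chainLaw ε h) := by
    refine Integrable.of_bound (hF.comp (measurable_pair n)).aestronglyMeasurable 1
      (Eventually.of_forall fun ω => ?_)
    rw [Real.norm_eq_abs, abs_of_nonneg (hF0 _ _)]
    exact hF1 _ _
  filter_upwards [(integral_eq_zero_iff_of_nonneg (fun ω => hF0 _ _) hint).1 hzero] with ω hω
  by_contra hne
  simp [F, hne] at hω

theorem measurable_martDiffSeq (ε : ℝ) (u : Param → State → ℝ) (n : ℕ) :
    Measurable (martDiffSeq ε u n) := by
  unfold martDiffSeq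
  split_ifs
  · exact (measurable_of_finite fun q : (State × Param) × (State × Param) =>
      martDiff ε u q.1 q.2).comp (measurable_pair n)
  · exact measurable_const

/-- The strong law of large numbers for the adaptive chain. -/
theorem ae_tendsto_average_chain {ε : ℝ} (h : Admissible ε) (f : State → ℝ) :
    ∀ᵐ ω ∂(chainLaw ε h),
      Tendsto (fun N : ℕ => (1 / (N : ℝ)) * ∑ i ∈ Finset.range N, f (chain i ω))
        atTop (𝓝 (∫ x, f x ∂(target ε h))) := by
  rw [integral_target]
  choose u hu using fun g => exists_poisson h g f
  obtain ⟨q, hq⟩ := Finite.exists_max fun q : (State × Param) × (State × Param) =>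
    |martDiff ε u q.1 q.2|
  obtain ⟨x, hx⟩ := Finite.exists_max fun x => |f x - mean ε f|
  obtain ⟨s, hs⟩ := Finite.exists_max fun s : State × Param => |u s.2 s.1|
  have hd (i : ℕ) (ω : ℕ → State × Param) :
      |martDiffSeq ε u i ω| ≤ |martDiff ε u q.1 q.2| := by
    unfold martDiffSeq
    split_ifs
    · exact hq (ω i, ω (i + 1))
    · rw [abs_zero]
      exact abs_nonneg _
  filter_upwards [ae_tendsto_average_of_orthogonal (measurable_martDiffSeq ε u) hd
    fun i j hij => martDiffSeq_orthogonal h u hij,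
    ae_all_iff.2 fun n : {n : ℕ // ¬ IsExceptionalTime n} =>
      ae_param_eq h (two_le_of_not_isExceptionalTime n.2)
        fun hn => n.2 hn.isExceptionalTime] with ω hω hkeep
  -- By the Poisson equation the remainder is `u` at time `i` minus `u` at time `i + 1`, both with
  -- the parameter at time `i`. Where that parameter is kept this is an increment of `w`.
  have htel : Tendsto (fun N : ℕ => (1 / (N : ℝ)) * ∑ i ∈ Finset.range N,
      (f (ω i).1 - mean ε f - martDiffSeq ε u i ω)) atTop (𝓝 0) := by
    refine tendsto_average_of_telescoping (w := fun i => u (ω i).2 (ω i).1)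
      (C := |f x - mean ε f| + |martDiff ε u q.1 q.2| + |u s.2 s.1|) (fun i => ?_) (fun i => ?_)
      fun i hi => ?_
    · refine (abs_sub _ _).trans ?_
      linarith [hx (ω i).1, hd i ω, abs_nonneg (u s.2 s.1)]
    · linarith [hs (ω i), abs_nonneg (f x - mean ε f), abs_nonneg (martDiff ε u q.1 q.2)]
    · have h1 := hkeep ⟨i, hi⟩
      simp only at h1
      simp only [martDiffSeq, if_pos (two_le_of_not_isExceptionalTime hi), martDiff, hu (ω i).2, h1]
      ring
  have hsum := (htel.add hω).add_const (mean ε f)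
  rw [add_zero, zero_add] at hsum
  refine hsum.congr' ?_
  filter_upwards [eventually_ge_atTop 1] with N hN
  have hN0 : (N : ℝ) ≠ 0 := by exact_mod_cast (by omega : N ≠ 0)
  simp only [Finset.sum_sub_distrib, Finset.sum_const, Finset.card_range, nsmul_eq_mul, chain]
  field_simp
  ring

end AirMCMC

theorem mainTheorem6 :
    (∀ (ε : ℝ) (h : AirMCMC.Admissible ε),
      (∃ C : Set AirMCMC.State,
        AirMCMC.RegularAndSmallSet (AirMCMC.target ε h) (AirMCMC.metropolis ε h) C ∧
        AirMCMC.SimultaneousGeometricDrift (AirMCMC.metropolis ε h) C) ∧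
      (∀ f : AirMCMC.State → ℝ,
        ∀ᵐ ω ∂(AirMCMC.chainLaw ε h),
          Tendsto (fun N : ℕ => (1 / (N : ℝ)) * ∑ i ∈ Finset.range N, f (AirMCMC.chain i ω))
            atTop (𝓝 (∫ x, f x ∂(AirMCMC.target ε h))))) ∧
    (∃ ε₀ : ℝ, 0 < ε₀ ∧ ∀ (ε : ℝ) (h : AirMCMC.Admissible ε), ε < ε₀ →
      ¬ AirMCMC.ConvergesInDistribution (AirMCMC.chainLaw ε h) AirMCMC.chain) := by
  refine ⟨fun ε h => ⟨⟨{2, 3}, AirMCMC.regularAndSmallSet_metropolis h,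
    AirMCMC.simultaneousGeometricDrift_metropolis h⟩, AirMCMC.ae_tendsto_average_chain h⟩,
    1 / 4, by norm_num, fun ε h hlt => AirMCMC.not_convergesInDistribution_chain h hlt⟩
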